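/- A tree is a partially ordered set $(T,\preccurlyeq)$ in which, for every $t\in T$, the set $\{s\in T: s\preccurlyeq t\}$ is finite and linearly ordered; its initial nodes are its minimal elements. A branch of $T$ is a non-empty linearly ordered subset of $T$ closed under taking direct predecessors. The tree space $[T]$ is the set of all branches, with the topology generated by the sets $U_t=\{b\in[T]: t\in b\}$ and their complements ($t\in T$); if $T$ has finitely many initial nodes, $[T]$ is compact and $T$ is called compact. $C([T])$ denotes the Banach space of real continuous functions on $[T]$ with the supremum norm. $T$ is well-founded if all its branches are finite; in that case $[T]$ is identified with $T$, and the ordinal index $\mathrm{o}(T)$ is the least ordinal $\alpha$ with $T^{(\alpha)}=\emptyset$, where $T^{(0)}=T$, $T^{(\alpha+1)}$ is obtained from $T^{(\alpha)}$ by removing its maximal elements, and $T^{(\alpha)}=\bigcap_{\gamma<\alpha}T^{(\gamma)}$ for limit $\alpha$. For a real Banach space $X$, $\varepsilon>0$ and $F\subset X^*$, let $F'_\varepsilon$ be the set of those $f\in F$ such that the norm-diameter of $U\cap F$ is at least $\varepsilon$ for every $w^*$-open $U\ni f$. Put $F^{(0)}_\varepsilon=F$, $F^{(\alpha+1)}_\varepsilon=(F^{(\alpha)}_\varepsilon)'_\varepsilon$,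 and $F^{(\alpha)}_\varepsilon=\bigcap_{\gamma<\alpha}F^{(\gamma)}_\varepsilon$ for limit $\alpha$. The $\varepsilon$-Szlenk index $\mathrm{Sz}(X,\varepsilon)$ is the least ordinal $\alpha$ with $(B_{X^*})^{(\alpha)}_\varepsilon=\emptyset$, and $\infty$ if there is none. $X$ is an Asplund space if every separable subspace of $X$ has separable dual. **Theorem.** Let $X$ be a real Asplund (Banach) space, $(T,\preccurlyeq)$ a tree with finitely many initial nodes, and $i\colon X\to C([T])$ a linear isometric embedding. Then for every $\varepsilon>0$, $\mathrm{Sz}(X,\varepsilon/2)$ is an ordinal, and there exist a well-founded, compact tree $S$ with $\mathrm{o}(S)<\mathrm{Sz}(X,\varepsilon/2)+\omega$ and a linear subspace $Y$ of $C([T])$ that is linearly isometric to $C(S)$, such that for every $x\in X$ there is $y\in Y$ with $\|i(x)-y\|\le\varepsilon\|x\|$. -/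

import Mathlib

open scoped ENNReal

universe u v w

/-! ### Trees and their tree spaces -/

/-- A tree: a partially ordered set in which the set of predecessors `{s | s ≤ t}` of every
element `t` is finite and linearly ordered. -/
class IsTreeOrder (T : Type u) [PartialOrder T] : Prop where
  finite_Iic : ∀ t : T, (Set.Iic t).Finite
  isChain_Iic : ∀ t : T, IsChain (· ≤ ·) (Set.Iic t)

/-- The tree has finitely many initial nodes (minimal elements). -/
class FinitelyManyInitialNodes (T : Type u) [PartialOrder T] : Prop where
  finite_isMin : {t : T | IsMin t}.Finite

/-- A branch: a non-empty linearly ordered subset which is closed under taking direct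
predecessors (`s ⋖ t` says that `s < t` with nothing strictly in between). -/
structure IsBranch {T : Type u} [PartialOrder T] (b : Set T) : Prop where
  nonempty : b.Nonempty
  isChain : IsChain (· ≤ ·) b
  mem_of_covBy : ∀ t ∈ b, ∀ s, s ⋖ t → s ∈ b

/-- The tree space `[T]`: the set of all (finite and infinite) branches of `T`. -/
@[ext]
structure TreeSpace (T : Type u) [PartialOrder T] : Type u where
  /-- The nodes lying on the branch. -/
  carrier : Set T
  isBranch : IsBranch carrier

/-- The set `U_t` of all branches containing `t`. -/
def TreeSpace.U {T : Type u} [PartialOrder T] (t : T) : Set (TreeSpace T) := {b | t ∈ b.carrier}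

/-- The tree topology, generated by the sets `U_t` and their complements. -/
instance TreeSpace.instTopologicalSpace (T : Type u) [PartialOrder T] :
    TopologicalSpace (TreeSpace T) :=
  TopologicalSpace.generateFrom
    (Set.range (TreeSpace.U (T := T)) ∪ Set.range (fun t : T => (TreeSpace.U t)ᶜ))

/-- A tree is well-founded if it has no infinite branch. -/
def IsWellFoundedTree (T : Type u) [PartialOrder T] : Prop :=
  ∀ b : TreeSpace T, b.carrier.Finite

/-- Every branch contains an initial node. -/
theorem IsBranch.exists_isMin {T : Type u} [PartialOrder T] [IsTreeOrder T] {b : Set T}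
    (hb : IsBranch b) : ∃ m ∈ b, IsMin m := by
  obtain ⟨t, ht⟩ := hb.nonempty
  have hfin : (Set.Iic t ∩ b).Finite := (IsTreeOrder.finite_Iic t).subset Set.inter_subset_left
  obtain ⟨m, hm⟩ := hfin.exists_minimal ⟨t, le_refl t, ht⟩
  refine ⟨m, hm.prop.2, ?_⟩
  by_contra hmin
  obtain ⟨s, hs⟩ := not_isMin_iff.1 hmin
  have hfin' : (Set.Iio m).Finite := (IsTreeOrder.finite_Iic m).subset Set.Iio_subset_Iic_self
  obtain ⟨p, hp⟩ := hfin'.exists_maximal ⟨s, hs⟩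
  have hpm : p < m := hp.prop
  have hcov : p ⋖ m :=
    ⟨hpm, fun c hpc hcm => absurd (hp.le_of_ge (show c ∈ Set.Iio m from hcm) hpc.le) hpc.not_ge⟩
  have hpb : p ∈ b := hb.mem_of_covBy m hm.prop.2 p hcov
  exact hpm.not_ge (hm.le_of_le ⟨hpm.le.trans hm.prop.1, hpb⟩ hpm.le)

/-- The tree space of a tree with finitely many initial nodes is compact; this makes the space
`C(TreeSpace T, ℝ)` of continuous functions a Banach space in the supremum norm. -/
instance TreeSpace.instCompactSpace (T : Type u) [PartialOrder T] [IsTreeOrder T]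
    [FinitelyManyInitialNodes T] : CompactSpace (TreeSpace T) := by
  refine ⟨isCompact_iff_ultrafilter_le_nhds.2 fun f _ => ?_⟩
  have hbr : IsBranch {t : T | TreeSpace.U t ∈ f} := by
    refine ⟨?_, ?_, ?_⟩
    · have huniv : (⋃ t ∈ {t : T | IsMin t}, TreeSpace.U t) ∈ f := by
        refine Filter.mem_of_superset Filter.univ_mem fun b _ => ?_
        obtain ⟨m, hmb, hm⟩ := b.isBranch.exists_isMin
        exact Set.mem_biUnion hm hmb
      obtain ⟨t, -, ht⟩ :=
        (Ultrafilter.finite_biUnion_mem_iff FinitelyManyInitialNodes.finite_isMin).1 huniv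
      exact ⟨t, ht⟩
    · intro s hs t ht hne
      obtain ⟨b, hbs, hbt⟩ := f.nonempty_of_mem (Filter.inter_mem hs ht)
      exact b.isBranch.isChain hbs hbt hne
    · intro t ht s hst
      exact Filter.mem_of_superset ht fun b hb => b.isBranch.mem_of_covBy t hb s hst
  refine ⟨⟨_, hbr⟩, Set.mem_univ _, ?_⟩
  rw [TopologicalSpace.nhds_generateFrom]
  refine le_iInf₂ fun s hs => Filter.le_principal_iff.2 ?_
  obtain ⟨hbs, ⟨t, rfl⟩ | ⟨t, rfl⟩⟩ := hs
  · exact hbs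
  · exact Ultrafilter.compl_mem_iff_notMem.2 hbs

/-! ### Transfinite derivatives and their indices -/

/-- The transfinite iteration of a set derivation `D` starting from `A`:
`A^(0) = A`, `A^(α+1) = D (A^(α))`, and `A^(α) = ⋂ γ < α, A^(γ)` at limit ordinals. -/
noncomputable def iterDeriv {K : Type u} (D : Set K → Set K) (A : Set K)
    (α : Ordinal.{w}) : Set K :=
  Ordinal.limitRecOn (motive := fun _ => Set K) α A (fun _ B => D B)
    (fun α _ B => ⋂ (γ : Ordinal.{w}) (h : γ < α), B γ h)

open Classical in
/-- The least ordinal `α` with `A^(α) = ∅`, and `⊤` (playing the role of `∞`) if there is none.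
The ordinals range over a universe at least as large as that of `K`. -/
noncomputable def derivIndex {K : Type u} (D : Set K → Set K) (A : Set K) :
    WithTop Ordinal.{max u v} :=
  if ∃ α : Ordinal.{max u v}, iterDeriv D A α = ∅ then
    ((sInf {α : Ordinal.{max u v} | iterDeriv D A α = ∅} : Ordinal.{max u v}) :
      WithTop Ordinal.{max u v})
  else ⊤

/-- `S'`: the elements of `S` which are not maximal in `S`. -/
def removeMaximal {T : Type u} [PartialOrder T] (S : Set T) : Set T :=
  {s ∈ S | ¬ Maximal (· ∈ S) s}

/-- The ordinal index `o(T)` of a (well-founded) tree. -/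
noncomputable def treeIndex (T : Type u) [PartialOrder T] : WithTop Ordinal.{max u v} :=
  derivIndex.{u, v} (removeMaximal (T := T)) Set.univ

/-- The diameter of `A` with respect to a pseudo-metric `d`. -/
noncomputable def diamWrt {K : Type u} (d : K → K → ℝ) (A : Set K) : ℝ≥0∞ :=
  ⨆ (x ∈ A) (y ∈ A), ENNReal.ofReal (d x y)

/-- The `ε`-derivative of `F` with respect to the pseudo-metric `d`: the points of `F` all of whose
open neighbourhoods `U` satisfy `d-diam (U ∩ F) ≥ ε`. -/
def fragDeriv {K : Type u} [TopologicalSpace K] (d : K → K → ℝ) (ε : ℝ) (F : Set K) : Set K :=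
  {x ∈ F | ∀ U : Set K, IsOpen U → x ∈ U → ENNReal.ofReal ε ≤ diamWrt d (U ∩ F)}

/-- The `ε`-fragmentation index of `F` with respect to the pseudo-metric `d`. -/
noncomputable def fragIndex {K : Type u} [TopologicalSpace K] (d : K → K → ℝ) (F : Set K) (ε : ℝ) :
    WithTop Ordinal.{max u v} :=
  derivIndex.{u, v} (fragDeriv d ε) F

/-! ### Szlenk index and Asplund spaces -/

/-- The `ε`-Szlenk index `Sz(X, ε)`: the `ε`-fragmentation index of the closed unit ball of the
dual of `X`, with its weak-star topology, with respect to the metric of the dual norm. -/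
noncomputable def szlenkIndex (X : Type u) [NormedAddCommGroup X] [NormedSpace ℝ X] (ε : ℝ) :
    WithTop Ordinal.{max u v} :=
  fragIndex.{u, v} (K := WeakDual ℝ X)
    (fun f g => ‖WeakDual.toStrongDual f - WeakDual.toStrongDual g‖)
    {f | ‖WeakDual.toStrongDual f‖ ≤ 1} ε

/-- Asplund spaces: every separable subspace has (norm-)separable dual. -/
def IsAsplund (X : Type u) [NormedAddCommGroup X] [NormedSpace ℝ X] : Prop :=
  ∀ E : Submodule ℝ X, TopologicalSpace.SeparableSpace E →
    TopologicalSpace.SeparableSpace (StrongDual ℝ E)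

/-!
For a point `c` of the compact space `K = TreeSpace T` let `φ c` be the functional `x ↦ i x c`, and
put `d b c = ‖φ b - φ c‖`. Each `i x` is `‖x‖`-Lipschitz for `d`, so it suffices to find a
continuous map `q` of `K` onto the tree space of a well-founded tree `S` of small index, such that
each fibre of `q` lies in a `d`-ball of radius `ε / 2` around one of its points. Indeed, for `x ≠
0` the function `i x` is then strictly within `ε ‖x‖` of a constant on every fibre, and, as `q` is
a closed map, of the same constant on the neighbouring fibres; a partition of unity then gives a
function `g` with `‖i x - g ∘ q‖ ≤ ε ‖x‖` (`exists_abs_sub_comp_le`). So `Y = {g ∘ q}` is the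
required subspace.

The preimages `A α` under `φ` of the `ε / 2`-Szlenk derivatives of the dual ball form a decreasing
sequence of closed sets, exhausted at `σ = Sz(X, ε / 2)`, and every point of `A α \ A (α + 1)` has
a neighbourhood whose trace on `A α` has `d`-diameter at most `ε / 2`
(`WeakDual.isSlicing_preimage`). A clopen set `V` has a rank: the last `α` for which `A α` meets
`V`. By compactness every clopen set is a finite disjoint union of clopen sets `V` whose top slice
`V ∩ A α` lies in a ball `d b · ≤ ε / 2` with `b` in the slice (`IsSlicing.isFinitelySmallTop`).
Starting from such a decomposition of `K`, each `V` is cut along this ball. What is outside the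
ball is open, and in a tree space every open set is a disjoint union of clopen sets
(`TreeSpace.exists_clopen_partition`), hence of clopen sets with small top slice; they miss the top
slice of `V`, so their rank is smaller (`IsSlicing.exists_splitting`). The sets obtained by
iteration form, under reverse inclusion, the tree `S`. Since ranks are below `σ` and strictly
decrease along `S`, the tree is well-founded and `o(S) ≤ σ` (`NodeTree.treeIndex_le`). The map `q`
sends `c` to the branch of all members of `S` containing `c`, and its fibres are the parts of the
nodes `V` inside the balls along which they are cut.

That `σ` is an ordinal for an Asplund space is the usual dyadic tree argument
(`IsAsplund.not_forall_le_diamWrt`): otherwise the derivatives stabilise at a non-empty set all of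
whose relatively weak-star open subsets have large diameter, and a Cantor scheme in it gives
continuum many functionals that are uniformly separated on a separable subspace.
-/

/-! ### Iterated derivatives -/

section iterDeriv

variable {K : Type u} {D : Set K → Set K} {A : Set K}

theorem iterDeriv_zero : iterDeriv D A (0 : Ordinal.{w}) = A :=
  Ordinal.limitRecOn_zero _ _ _

theorem iterDeriv_add_one (α : Ordinal.{w}) :
    iterDeriv D A (α + 1) = D (iterDeriv D A α) :=
  Ordinal.limitRecOn_add_one _ _ _ _

theorem iterDeriv_limit {α : Ordinal.{w}} (h : Order.IsSuccLimit α) :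
    iterDeriv D A α = ⋂ γ < α, iterDeriv D A γ :=
  Ordinal.limitRecOn_limit _ _ _ _ h

theorem iterDeriv_antitone (hD : ∀ B, D B ⊆ B) :
    Antitone (iterDeriv D A : Ordinal.{w} → Set K) := by
  intro α β
  induction β using Ordinal.limitRecOn with
  | zero => intro h; rw [nonpos_iff_eq_zero.1 h]
  | add_one β ih =>
    intro h
    rcases h.eq_or_lt with rfl | h
    · exact le_rfl
    · rw [iterDeriv_add_one]
      exact (hD _).trans (ih (Order.lt_add_one_iff.1 h))
  | limit β hβ ih =>
    intro h
    rcases h.eq_or_lt with rfl | h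
    · exact le_rfl
    · rw [iterDeriv_limit hβ]
      exact Set.iInter₂_subset α h

/-- By cardinality, a decreasing transfinite iteration reaches a fixed point of the derivation. -/
theorem exists_iterDeriv_fixed (hD : ∀ B, D B ⊆ B) :
    ∃ α : Ordinal.{max u v}, D (iterDeriv D A α) = iterDeriv D A α := by
  by_contra! h
  have hne : ∀ α : Ordinal.{max u v}, ∃ x, x ∈ iterDeriv D A α ∧ x ∉ iterDeriv D A (α + 1) := by
    intro α
    by_contra! h'
    exact h α ((hD _).antisymm fun x hx => iterDeriv_add_one (D := D) (A := A) α ▸ h' x hx)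
  choose x hx hx' using hne
  refine not_injective_of_ordinal (α := ULift.{v} K) (fun α => ⟨x α⟩) fun α β hαβ => ?_
  have hαβ : x α = x β := congrArg ULift.down hαβ
  by_contra hne
  rcases lt_or_gt_of_ne hne with hlt | hlt
  · exact hx' α (hαβ ▸ iterDeriv_antitone hD (Order.add_one_le_of_lt hlt) (hx β))
  · exact hx' β (hαβ ▸ iterDeriv_antitone hD (Order.add_one_le_of_lt hlt) (hx α))

theorem exists_iterDeriv_empty_of_derivIndex_ne_top (h : derivIndex.{u, v} D A ≠ ⊤) :
    ∃ σ : Ordinal.{max u v}, derivIndex.{u, v} D A = σ ∧ iterDeriv D A σ = ∅ := by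
  unfold derivIndex at h ⊢
  split_ifs at h ⊢ with hex
  · exact ⟨_, rfl, csInf_mem (s := {α | iterDeriv D A α = ∅}) hex⟩
  · exact absurd rfl h

theorem derivIndex_le {σ : Ordinal.{max u v}} (h : iterDeriv D A σ = ∅) :
    derivIndex.{u, v} D A ≤ σ := by
  unfold derivIndex
  rw [if_pos ⟨σ, h⟩]
  exact WithTop.coe_le_coe.2 (csInf_le' h)

end iterDeriv

section fragDeriv

variable {K : Type u} {d : K → K → ℝ} {ε : ℝ}

theorem exists_lt_of_le_diamWrt {S : Set K} {δ : ℝ} (hδ : 0 ≤ δ) (hlt : δ < ε)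
    (h : ENNReal.ofReal ε ≤ diamWrt d S) : ∃ x ∈ S, ∃ y ∈ S, δ < d x y := by
  by_contra! h'
  have : diamWrt d S ≤ ENNReal.ofReal δ :=
    iSup₂_le fun x hx => iSup₂_le fun y hy => ENNReal.ofReal_le_ofReal (h' x hx y hy)
  exact absurd ((ENNReal.ofReal_le_ofReal_iff hδ).1 (h.trans this)) hlt.not_ge

theorem le_of_diamWrt_lt {S : Set K} (h : diamWrt d S < ENNReal.ofReal ε) {x y : K} (hx : x ∈ S)
    (hy : y ∈ S) : d x y ≤ ε := by
  have h1 : ENNReal.ofReal (d x y) ≤ diamWrt d S :=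
    le_iSup₂_of_le x hx (le_iSup₂_of_le y hy le_rfl)
  exact ((ENNReal.ofReal_lt_ofReal_iff').1 (h1.trans_lt h)).1.le

variable [TopologicalSpace K]

theorem fragDeriv_subset (F : Set K) : fragDeriv d ε F ⊆ F := fun _ hx => hx.1

theorem IsClosed.fragDeriv {F : Set K} (hF : IsClosed F) : IsClosed (fragDeriv d ε F) := by
  rw [← isOpen_compl_iff, isOpen_iff_forall_mem_open]
  intro x hx
  by_cases hxF : x ∈ F
  · have : ∃ U : Set K, IsOpen U ∧ x ∈ U ∧ ¬ ENNReal.ofReal ε ≤ diamWrt d (U ∩ F) := by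
      by_contra! h
      exact hx ⟨hxF, h⟩
    obtain ⟨U, hU, hxU, hd⟩ := this
    exact ⟨U, fun y hy hy' => hd (hy'.2 U hU hy), hU, hxU⟩
  · exact ⟨Fᶜ, fun y hy hy' => hy hy'.1, hF.isOpen_compl, hxF⟩

theorem IsClosed.iterDeriv_fragDeriv {F : Set K} (hF : IsClosed F) (α : Ordinal.{w}) :
    IsClosed (iterDeriv (_root_.fragDeriv d ε) F α) := by
  induction α using Ordinal.limitRecOn with
  | zero => rwa [iterDeriv_zero]
  | add_one α ih => rw [iterDeriv_add_one]; exact ih.fragDeriv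
  | limit α hα ih => rw [iterDeriv_limit hα]; exact isClosed_biInter ih

end fragDeriv

/-! ### Szlenk index of Asplund spaces -/

section Szlenk

variable {X : Type u} [NormedAddCommGroup X] [NormedSpace ℝ X]

theorem exists_apply_gt_of_lt_norm {f : StrongDual ℝ X} {δ : ℝ} (hδ : 0 ≤ δ) (h : δ < ‖f‖) :
    ∃ x, ‖x‖ ≤ 1 ∧ δ < f x := by
  by_contra! h'
  refine h.not_ge (f.opNorm_le_of_unit_norm hδ fun x hx => ?_)
  rw [Real.norm_eq_abs, abs_le]
  refine ⟨?_, h' x hx.le⟩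
  have := h' (-x) (by rw [norm_neg]; exact hx.le)
  rw [map_neg] at this
  linarith

/-- A non-empty bounded set of functionals all of whose non-empty relatively weak-star open subsets
have large diameter produces a separable subspace with non-separable dual: a dyadic tree of open
sets separated by countably many vectors yields continuum many functionals which are uniformly
separated on the span of these vectors. -/
theorem IsAsplund.not_forall_le_diamWrt (hX : IsAsplund X) {ε : ℝ} (hε : 0 < ε)
    {F : Set (WeakDual ℝ X)} (hF : F ⊆ {f | ‖WeakDual.toStrongDual f‖ ≤ 1}) (hne : F.Nonempty)
    (hdiam : ∀ U : Set (WeakDual ℝ X), IsOpen U → (U ∩ F).Nonempty → ENNReal.ofReal ε ≤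
      diamWrt (fun f g => ‖WeakDual.toStrongDual f - WeakDual.toStrongDual g‖) (U ∩ F)) :
    False := by
  have hcpt : IsCompact {f : WeakDual ℝ X | ‖WeakDual.toStrongDual f‖ ≤ 1} := by
    have := WeakDual.isCompact_closedBall (𝕜 := ℝ) (E := X) 0 1
    convert this using 1
    ext f
    simp
  let St := {U : Set (WeakDual ℝ X) // IsOpen U ∧ (U ∩ F).Nonempty}
  have hsplit : ∀ U : St, ∃ (x : X) (a b : ℝ) (U₀ U₁ : St), ‖x‖ ≤ 1 ∧ ε / 2 ≤ a - b ∧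
      U₀.1 ⊆ U.1 ∧ U₁.1 ⊆ U.1 ∧ (∀ f ∈ U₀.1, a ≤ f x) ∧ (∀ f ∈ U₁.1, f x ≤ b) := by
    rintro ⟨U, hU, hUF⟩
    obtain ⟨f, hf, g, hg, hfg⟩ := exists_lt_of_le_diamWrt (half_pos hε).le (half_lt_self hε)
      (hdiam U hU hUF)
    obtain ⟨x, hx, hfgx⟩ := exists_apply_gt_of_lt_norm (half_pos hε).le hfg
    have hfgx : ε / 2 < f x - g x := hfgx
    have hcont : Continuous fun h : WeakDual ℝ X => h x := WeakDual.eval_continuous x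
    -- `η` is chosen so that the two half-spaces stay a distance `ε / 2` apart at `x`
    set η := (f x - g x - ε / 2) / 2 with hη
    refine ⟨x, f x - η, g x + η,
      ⟨U ∩ {h | f x - η < h x}, hU.inter (isOpen_lt continuous_const hcont),
        f, ⟨hf.1, ?_⟩, hf.2⟩,
      ⟨U ∩ {h | h x < g x + η}, hU.inter (isOpen_lt hcont continuous_const),
        g, ⟨hg.1, ?_⟩, hg.2⟩, hx, ?_, Set.inter_subset_left, Set.inter_subset_left,
      fun h hh => hh.2.le, fun h hh => hh.2.le⟩
    · show f x - η < f x
      linarith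
    · show g x < g x + η
      linarith
    · linarith
  choose x a b U₀ U₁ hx hab hU₀ hU₁ ha hb using hsplit
  -- the dyadic tree of open sets, and the initial segments of a 0-1-sequence, in reverse order
  let node : List Bool → St := fun l => l.rec
    ⟨Set.univ, isOpen_univ, by simpa using hne⟩ fun c _ U => bif c then U₁ U else U₀ U
  let pre : (ℕ → Bool) → ℕ → List Bool := fun s n => n.rec [] fun k l => s k :: l
  have hnode : ∀ s n, node (pre s (n + 1)) =
      bif s n then U₁ (node (pre s n)) else U₀ (node (pre s n)) := fun _ _ => rfl
  have hsub : ∀ s n, (node (pre s (n + 1))).1 ⊆ (node (pre s n)).1 := by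
    intro s n
    rw [hnode]
    cases s n
    · exact hU₀ _
    · exact hU₁ _
  have hpt : ∀ s : ℕ → Bool, ∃ h : WeakDual ℝ X, ∀ n, h ∈ closure ((node (pre s n)).1 ∩ F) := by
    intro s
    have hcl : ∀ n, closure ((node (pre s n)).1 ∩ F) ⊆ {f | ‖WeakDual.toStrongDual f‖ ≤ 1} :=
      fun n => closure_minimal (Set.inter_subset_right.trans hF) hcpt.isClosed
    obtain ⟨h, hh⟩ := IsCompact.nonempty_iInter_of_sequence_nonempty_isCompact_isClosed
      (fun n => closure ((node (pre s n)).1 ∩ F))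
      (fun n => closure_mono (Set.inter_subset_inter_left _ (hsub s n)))
      (fun n => (node (pre s n)).2.2.closure)
      (hcpt.of_isClosed_subset isClosed_closure (hcl 0)) (fun _ => isClosed_closure)
    exact ⟨h, Set.mem_iInter.1 hh⟩
  choose h hh using hpt
  have hlow : ∀ s n, s n = false → a (node (pre s n)) ≤ h s (x (node (pre s n))) := by
    intro s n hs
    refine closure_minimal (fun f hf => ?_)
      (isClosed_le continuous_const (WeakDual.eval_continuous (x (node (pre s n))))) (hh s (n + 1))
    rw [hnode, hs] at hf
    exact ha _ f hf.1
  have hupp : ∀ s n, s n = true → h s (x (node (pre s n))) ≤ b (node (pre s n)) := by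
    intro s n hs
    refine closure_minimal (fun f hf => ?_)
      (isClosed_le (WeakDual.eval_continuous (x (node (pre s n)))) continuous_const) (hh s (n + 1))
    rw [hnode, hs] at hf
    exact hb _ f hf.1
  -- the separable subspace spanned by the countably many separating vectors
  let E : Submodule ℝ X := Submodule.span ℝ (Set.range fun l => x (node l))
  have hEsep : TopologicalSpace.IsSeparable (E : Set X) :=
    (Set.countable_range _).isSeparable.span
  have := hX E hEsep.separableSpace
  let g : (ℕ → Bool) → StrongDual ℝ E := fun s =>
    (WeakDual.toStrongDual (h s)).comp E.subtypeL
  have hsep : ∀ s t : ℕ → Bool, s ≠ t → ε / 2 ≤ ‖g s - g t‖ := by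
    intro s t hst
    -- up to the first index where `s` and `t` differ they follow the same nodes
    have hex : ∃ n, s n ≠ t n := Function.ne_iff.1 hst
    classical
    have hpre : ∀ n ≤ Nat.find hex, pre s n = pre t n := by
      intro n hn
      induction n with
      | zero => rfl
      | succ k ih =>
        have hk : s k = t k := not_not.1 (Nat.find_min hex (Nat.lt_of_succ_le hn))
        show s k :: pre s k = t k :: pre t k
        rw [hk, ih (Nat.le_of_succ_le hn)]
    have hN := Nat.find_spec hex
    set n := Nat.find hex
    have hn := hpre n le_rfl
    let e : E := ⟨x (node (pre s n)), Submodule.subset_span ⟨_, rfl⟩⟩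
    have he : ‖e‖ ≤ 1 := hx _
    have hle : |g s e - g t e| ≤ ‖g s - g t‖ := by
      have := (g s - g t).le_opNorm e
      rw [← Real.norm_eq_abs]
      exact this.trans (mul_le_of_le_one_right (norm_nonneg _) he)
    have hge : g s e = h s (x (node (pre s n))) := rfl
    have hge' : g t e = h t (x (node (pre s n))) := rfl
    have hab' := hab (node (pre s n))
    refine le_trans ?_ hle
    cases hs : s n
    · have ht : t n = true := by
        cases ht : t n
        · exact absurd (hs.trans ht.symm) hN
        · rfl
      have h1 := hlow s n hs
      have h2 := hupp t n ht
      rw [← hn] at h2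
      exact le_trans (by linarith) (le_abs_self _)
    · have ht : t n = false := by
        cases ht : t n
        · rfl
        · exact absurd (hs.trans ht.symm) hN
      have h1 := hupp s n hs
      have h2 := hlow t n ht
      rw [← hn] at h2
      exact le_trans (by linarith) (neg_abs_le _ |> neg_le.1)
  have hcount : Countable (ℕ → Bool) := by
    refine Pairwise.countable_of_isOpen_disjoint (s := fun s => Metric.ball (g s) (ε / 4)) ?_
      (fun _ => Metric.isOpen_ball) fun s => ⟨g s, Metric.mem_ball_self (by linarith)⟩
    intro s t hst
    refine Metric.ball_disjoint_ball ?_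
    have hdist : dist (g s) (g t) = ‖g s - g t‖ := by
      exact dist_eq_norm (g s) (g t)
    linarith [hsep s t hst]
  obtain ⟨j, hj⟩ := exists_injective_nat (ℕ → Bool)
  refine Function.cantor_injective
    (fun (A : Set ℕ) => j fun n => @decide (n ∈ A) (Classical.dec _)) fun A B hAB => ?_
  ext n
  simpa using congrFun (hj hAB) n

theorem IsAsplund.szlenkIndex_ne_top (hX : IsAsplund X) {ε : ℝ} (hε : 0 < ε) :
    szlenkIndex.{u, v} X ε ≠ ⊤ := by
  set d : WeakDual ℝ X → WeakDual ℝ X → ℝ :=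
    fun f g => ‖WeakDual.toStrongDual f - WeakDual.toStrongDual g‖
  set B : Set (WeakDual ℝ X) := {f | ‖WeakDual.toStrongDual f‖ ≤ 1}
  obtain ⟨α, hα⟩ := exists_iterDeriv_fixed.{u, v} (A := B) (fragDeriv_subset (d := d) (ε := ε))
  have hempty : iterDeriv (fragDeriv d ε) B α = ∅ := by
    by_contra hne
    refine hX.not_forall_le_diamWrt hε ?_ (Set.nonempty_iff_ne_empty.2 hne) ?_
    · exact (iterDeriv_antitone fragDeriv_subset (zero_le (a := α))).trans iterDeriv_zero.subset
    · rintro U hU ⟨f, hfU, hf⟩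
      rw [← hα] at hf
      exact hf.2 U hU hfU
  exact ne_top_of_le_ne_top WithTop.coe_ne_top (derivIndex_le.{u, v} hempty)

end Szlenk

/-! ### Tree spaces -/

section TreeSpace

variable {T : Type u} [PartialOrder T]

theorem TreeSpace.isClopen_U (t : T) : IsClopen (TreeSpace.U t) :=
  ⟨⟨TopologicalSpace.isOpen_generateFrom_of_mem (Or.inr ⟨t, rfl⟩)⟩,
    TopologicalSpace.isOpen_generateFrom_of_mem (Or.inl ⟨t, rfl⟩)⟩

theorem TreeSpace.continuous_iff {K : Type v} [TopologicalSpace K] {f : K → TreeSpace T} :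
    Continuous f ↔ ∀ t, IsClopen (f ⁻¹' TreeSpace.U t) := by
  refine ⟨fun hf t => (TreeSpace.isClopen_U t).preimage hf, fun h => ?_⟩
  refine continuous_generateFrom_iff.2 ?_
  rintro s (⟨t, rfl⟩ | ⟨t, rfl⟩)
  · exact (h t).isOpen
  · exact (h t).compl.isOpen

instance TreeSpace.instTotallySeparatedSpace : TotallySeparatedSpace (TreeSpace T) := by
  rw [totallySeparatedSpace_iff_exists_isClopen]
  intro b c hbc
  by_cases h : b.carrier ⊆ c.carrier
  · obtain ⟨t, htc, htb⟩ := Set.not_subset.1 fun h' => hbc (TreeSpace.ext (h.antisymm h'))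
    exact ⟨(TreeSpace.U t)ᶜ, (TreeSpace.isClopen_U t).compl, htb, not_not.2 htc⟩
  · obtain ⟨t, htb, htc⟩ := Set.not_subset.1 h
    exact ⟨TreeSpace.U t, TreeSpace.isClopen_U t, htb, htc⟩

variable [IsTreeOrder T]

theorem IsBranch.mem_of_le {b : Set T} (hb : IsBranch b) {s t : T} (ht : t ∈ b) (hst : s ≤ t) :
    s ∈ b := by
  have hfin : (Set.Icc s t ∩ b).Finite :=
    (IsTreeOrder.finite_Iic t).subset fun x hx => hx.1.2
  obtain ⟨m, hm⟩ := hfin.exists_minimal ⟨t, ⟨hst, le_rfl⟩, ht⟩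
  rcases hm.prop.1.1.eq_or_lt with h | h
  · exact h ▸ hm.prop.2
  · exfalso
    have hfin' : (Set.Ico s m).Finite := (IsTreeOrder.finite_Iic m).subset fun x hx => hx.2.le
    obtain ⟨p, hp⟩ := hfin'.exists_maximal ⟨s, le_rfl, h⟩
    have hcov : p ⋖ m := ⟨hp.prop.2, fun c hpc hcm =>
      absurd (hp.le_of_ge (y := c) ⟨hp.prop.1.trans hpc.le, hcm⟩ hpc.le) hpc.not_ge⟩
    have hpb : p ∈ b := hb.mem_of_covBy m hm.prop.2 p hcov
    exact hp.prop.2.not_ge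
      (hm.le_of_le ⟨⟨hp.prop.1, hp.prop.2.le.trans hm.prop.1.2⟩, hpb⟩ hp.prop.2.le)

theorem isBranch_Iic (t : T) : IsBranch (Set.Iic t) :=
  ⟨⟨t, le_rfl⟩, IsTreeOrder.isChain_Iic t, fun _ hs _ hr => hr.le.trans hs⟩

/-- The finite branch with last node `t`. -/
def TreeSpace.ofNode (t : T) : TreeSpace T := ⟨Set.Iic t, isBranch_Iic t⟩

theorem TreeSpace.eq_ofNode_of_finite (b : TreeSpace T) (hb : b.carrier.Finite) :
    ∃ t ∈ b.carrier, b = TreeSpace.ofNode t := by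
  obtain ⟨t, ht⟩ := hb.exists_maximal b.isBranch.nonempty
  refine ⟨t, ht.prop, TreeSpace.ext (Set.Subset.antisymm (fun s hs => ?_)
    fun s hs => b.isBranch.mem_of_le ht.prop hs)⟩
  rcases b.isBranch.isChain.total hs ht.prop with h | h
  · exact h
  · exact ht.le_of_ge hs h

variable [FinitelyManyInitialNodes T]

/-- The sets `U t`, for `t` on an infinite branch, form a neighbourhood base of that branch. -/
theorem TreeSpace.exists_U_subset_of_infinite {b : TreeSpace T} (hb : b.carrier.Infinite)
    {O : Set (TreeSpace T)} (hO : IsOpen O) (hbO : b ∈ O) :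
    ∃ t ∈ b.carrier, TreeSpace.U t ⊆ O := by
  have : Nonempty b.carrier := b.isBranch.nonempty.to_subtype
  have hdir : Directed (· ⊇ ·) fun t : b.carrier => TreeSpace.U (t : T) := by
    rintro ⟨s, hs⟩ ⟨t, ht⟩
    rcases b.isBranch.isChain.total hs ht with h | h
    · exact ⟨⟨t, ht⟩, fun c hc => c.isBranch.mem_of_le hc h, subset_rfl⟩
    · exact ⟨⟨s, hs⟩, subset_rfl, fun c hc => c.isBranch.mem_of_le hc h⟩
  have hnhds : ∀ c ∈ ⋂ t : b.carrier, TreeSpace.U (t : T), O ∈ nhds c := by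
    intro c hc
    have hbc : b.carrier ⊆ c.carrier := fun t ht => Set.mem_iInter.1 hc ⟨t, ht⟩
    have : c = b := by
      refine TreeSpace.ext (Set.Subset.antisymm (fun s hs => ?_) hbc)
      by_contra hsb
      refine hb ((IsTreeOrder.finite_Iic s).subset fun t ht => ?_)
      rcases c.isBranch.isChain.total (hbc ht) hs with h | h
      · exact h
      · exact absurd (b.isBranch.mem_of_le ht h) hsb
    exact this ▸ hO.mem_nhds hbO
  obtain ⟨⟨t, ht⟩, htO⟩ := exists_subset_nhds_of_isCompact hdir
    (fun t => (TreeSpace.isClopen_U (t : T)).isClosed.isCompact) hnhds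
  exact ⟨t, ht, htO⟩

/-- Every open subset of the tree space is a disjoint union of clopen sets. An open set `O` is the
union of clopen sets `W t ⊆ U t`; since `U s` and `U t` are disjoint for incomparable `s`, `t`,
removing from `W t` the finitely many `W s` with `s < t` makes the family disjoint. -/
theorem TreeSpace.exists_clopen_partition {O : Set (TreeSpace T)} (hO : IsOpen O) :
    ∃ 𝒟 : Set (Set (TreeSpace T)), 𝒟.PairwiseDisjoint id ∧ (∀ D ∈ 𝒟, IsClopen D) ∧
      ⋃₀ 𝒟 = O := by
  have hW : ∀ t : T, ∃ W : Set (TreeSpace T), IsClopen W ∧ W ⊆ U t ∩ O ∧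
      (U t ⊆ O → W = U t) ∧ (ofNode t ∈ O → ofNode t ∈ W) := by
    intro t
    by_cases h : U t ⊆ O
    · exact ⟨U t, isClopen_U t, Set.subset_inter subset_rfl h, fun _ => rfl,
        fun _ => (le_refl t : t ≤ t)⟩
    · by_cases h' : ofNode t ∈ O
      · obtain ⟨W, hW, htW, hWO⟩ := compact_exists_isClopen_in_isOpen
          ((isClopen_U t).isOpen.inter hO) (x := ofNode t) ⟨(le_refl t : t ≤ t), h'⟩
        exact ⟨W, hW, hWO, fun h'' => absurd h'' h, fun _ => htW⟩
      · exact ⟨∅, isClopen_empty, Set.empty_subset _, fun h'' => absurd h'' h,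
          fun h'' => absurd h'' h'⟩
  choose W hWc hWU hWeq hWmem using hW
  -- finite branches are the points `ofNode t`; an infinite one has a neighbourhood `U t ⊆ O`
  have hcov : ∀ b ∈ O, ∃ t, b ∈ W t := by
    intro b hbO
    by_cases hb : b.carrier.Finite
    · obtain ⟨t, -, rfl⟩ := b.eq_ofNode_of_finite hb
      exact ⟨t, hWmem t hbO⟩
    · obtain ⟨t, htb, htO⟩ := exists_U_subset_of_infinite hb hO hbO
      exact ⟨t, (hWeq t htO).symm ▸ htb⟩
  let D : T → Set (TreeSpace T) := fun t => W t \ ⋃ s ∈ Set.Iio t, W s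
  refine ⟨Set.range D, ?_, ?_, ?_⟩
  · have hlt : ∀ s t, s < t → Disjoint (D s) (D t) := fun s t hst =>
      Set.disjoint_left.2 fun b hbs hbt => hbt.2 (Set.mem_biUnion hst hbs.1)
    rintro _ ⟨s, rfl⟩ _ ⟨t, rfl⟩ hst
    refine Set.disjoint_left.2 fun b hbs hbt => ?_
    have hne : s ≠ t := fun h => hst (h ▸ rfl)
    rcases b.isBranch.isChain.total (hWU s hbs.1).1 (hWU t hbt.1).1 with h | h
    · exact Set.disjoint_left.1 (hlt s t (h.lt_of_ne hne)) hbs hbt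
    · exact Set.disjoint_left.1 (hlt t s (h.lt_of_ne hne.symm)) hbt hbs
  · rintro _ ⟨t, rfl⟩
    exact (hWc t).diff <| Set.Finite.isClopen_biUnion
      ((IsTreeOrder.finite_Iic t).subset Set.Iio_subset_Iic_self) fun s _ => hWc s
  · refine Set.Subset.antisymm (Set.sUnion_subset ?_) fun b hbO => ?_
    · rintro _ ⟨t, rfl⟩ b hb
      exact (hWU t hb.1).2
    · obtain ⟨t, ht⟩ := hcov b hbO
      have hfin : (Set.Iic t ∩ {s | b ∈ W s}).Finite :=
        (IsTreeOrder.finite_Iic t).subset Set.inter_subset_left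
      obtain ⟨m, hm⟩ := hfin.exists_minimal ⟨t, le_rfl, ht⟩
      refine ⟨D m, ⟨m, rfl⟩, hm.prop.2, fun hb => ?_⟩
      obtain ⟨s, hs, hbs⟩ := Set.mem_iUnion₂.1 hb
      have hs : s < m := hs
      exact hs.not_ge (hm.le_of_le ⟨hs.le.trans hm.prop.1, hbs⟩ hs.le)

end TreeSpace

/-! ### Clopen sets with small top slices -/

section SmallTop

variable {K : Type u}

/-- The largest `α` such that `A α` meets `V`, if there is one (see `topRank_eq`), for decreasing
`A`. -/
noncomputable def topRank (A : Ordinal.{w} → Set K) (V : Set K) : Ordinal.{w} :=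
  sInf {α | Disjoint V (A (α + 1))}

theorem topRank_eq {A : Ordinal.{w} → Set K} (hA : Antitone A) {V : Set K} {α : Ordinal.{w}}
    (hV : Disjoint V (A (α + 1))) (hne : (V ∩ A α).Nonempty) : topRank A V = α := by
  refine le_antisymm (csInf_le' hV) (not_lt.1 fun hlt => ?_)
  have hmem : Disjoint V (A (topRank A V + 1)) :=
    csInf_mem (s := {α | Disjoint V (A (α + 1))}) ⟨α, hV⟩
  obtain ⟨b, hbV, hb⟩ := hne
  exact Set.disjoint_left.1 hmem hbV (hA (Order.add_one_le_of_lt hlt) hb)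

theorem Set.PairwiseDisjoint.union_of_disjoint_sUnion {𝒱 𝒲 : Set (Set K)}
    (h𝒱 : 𝒱.PairwiseDisjoint id) (h𝒲 : 𝒲.PairwiseDisjoint id) (h : Disjoint (⋃₀ 𝒱) (⋃₀ 𝒲)) :
    (𝒱 ∪ 𝒲).PairwiseDisjoint id :=
  Set.pairwiseDisjoint_union.2 ⟨h𝒱, h𝒲, fun _ hV _ hW _ =>
    h.mono (Set.subset_sUnion_of_mem hV) (Set.subset_sUnion_of_mem hW)⟩

variable [TopologicalSpace K]

/-- A decreasing transfinite sequence of closed subsets of `K`, starting from `K` and continuous at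
limit ordinals, such that every point of `A α \ A (α + 1)` has a neighbourhood whose trace on `A α`
has `d`-diameter at most `r`; moreover the closed `d`-balls of radius `r` are closed in the
topology of `K`. -/
structure IsSlicing (A : Ordinal.{w} → Set K) (d : K → K → ℝ) (r : ℝ) : Prop where
  zero : A 0 = Set.univ
  antitone : Antitone A
  limit : ∀ α, Order.IsSuccLimit α → A α = ⋂ γ < α, A γ
  isClosed : ∀ α, IsClosed (A α)
  small : ∀ α, ∀ b ∈ A α, b ∉ A (α + 1) →
    ∃ U : Set K, IsOpen U ∧ b ∈ U ∧ ∀ x ∈ U ∩ A α, ∀ y ∈ U ∩ A α, d x y ≤ r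
  isClosed_ball : ∀ b, IsClosed {c | d b c ≤ r}

/-- The set `V` is clopen, and the last set `A α` of the sequence that meets `V` does so inside the
`d`-ball of radius `r` around one of the points of `V ∩ A α`. -/
def IsSmallTop (A : Ordinal.{w} → Set K) (d : K → K → ℝ) (r : ℝ) (V : Set K) : Prop :=
  IsClopen V ∧ ∃ α, Disjoint V (A (α + 1)) ∧ ∃ b ∈ V ∩ A α, ∀ c ∈ V ∩ A α, d b c ≤ r

variable {A : Ordinal.{w} → Set K} {d : K → K → ℝ} {r : ℝ}

theorem IsSmallTop.exists_center (hA : Antitone A) {V : Set K} (hV : IsSmallTop A d r V) :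
    ∃ b ∈ V ∩ A (topRank A V), ∀ c ∈ V ∩ A (topRank A V), d b c ≤ r := by
  obtain ⟨-, α, hdis, b, hb, hball⟩ := hV
  rw [topRank_eq hA hdis ⟨b, hb⟩]
  exact ⟨b, hb, hball⟩

theorem IsSmallTop.topRank_lt (hA : Antitone A) {V : Set K} (hV : IsSmallTop A d r V)
    {α : Ordinal.{w}} (h : Disjoint V (A α)) : topRank A V < α := by
  obtain ⟨b, hb, -⟩ := hV.exists_center hA
  exact not_le.1 fun hle => Set.disjoint_left.1 h hb.1 (hA hle hb.2)

/-- The set `V` is the union of a finite disjoint family of sets with small top slice. -/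
def IsFinitelySmallTop (A : Ordinal.{w} → Set K) (d : K → K → ℝ) (r : ℝ) (V : Set K) : Prop :=
  ∃ 𝒲 : Set (Set K), 𝒲.Finite ∧ 𝒲.PairwiseDisjoint id ∧ (∀ W ∈ 𝒲, IsSmallTop A d r W) ∧ ⋃₀ 𝒲 = V

theorem isFinitelySmallTop_empty : IsFinitelySmallTop A d r ∅ :=
  ⟨∅, Set.finite_empty, Set.pairwiseDisjoint_empty, by simp, by simp⟩

theorem IsSmallTop.isFinitelySmallTop {V : Set K} (hV : IsSmallTop A d r V) :
    IsFinitelySmallTop A d r V :=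
  ⟨{V}, Set.finite_singleton V, Set.pairwiseDisjoint_singleton _ _, by simpa using hV, by simp⟩

theorem IsFinitelySmallTop.union {V W : Set K} (hV : IsFinitelySmallTop A d r V)
    (hW : IsFinitelySmallTop A d r W) (h : Disjoint V W) : IsFinitelySmallTop A d r (V ∪ W) := by
  obtain ⟨𝒱, h𝒱, hd𝒱, hs𝒱, rfl⟩ := hV
  obtain ⟨𝒲, h𝒲, hd𝒲, hs𝒲, rfl⟩ := hW
  exact ⟨𝒱 ∪ 𝒲, h𝒱.union h𝒲, hd𝒱.union_of_disjoint_sUnion hd𝒲 h,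
    fun U hU => hU.elim (hs𝒱 U) (hs𝒲 U), Set.sUnion_union 𝒱 𝒲⟩

/-- Induction step: a clopen set missing `A (α + 1)` whose part in `A α` is covered by finitely many
clopen sets on which `d` is small in `A α` is cut by these sets into pieces which either have small
top slice or miss `A α`. -/
theorem isFinitelySmallTop_of_cover {α : Ordinal.{w}}
    (ih : ∀ V, IsClopen V → Disjoint V (A α) → IsFinitelySmallTop A d r V)
    {𝒪 : Set (Set K)} (h𝒪 : 𝒪.Finite) (hc : ∀ O ∈ 𝒪, IsClopen O)
    (hs : ∀ O ∈ 𝒪, ∀ x ∈ O ∩ A α, ∀ y ∈ O ∩ A α, d x y ≤ r) :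
    ∀ V, IsClopen V → Disjoint V (A (α + 1)) → V ∩ A α ⊆ ⋃₀ 𝒪 → IsFinitelySmallTop A d r V := by
  induction 𝒪, h𝒪 using Set.Finite.induction_on with
  | empty =>
    intro V hV _ hcov
    refine ih V hV (Set.disjoint_iff_inter_eq_empty.2 ?_)
    rwa [Set.sUnion_empty, Set.subset_empty_iff] at hcov
  | @insert O 𝒪 _ _ ih𝒪 =>
    intro V hV hdis hcov
    have hO := hc O (Set.mem_insert O 𝒪)
    have h1 : IsFinitelySmallTop A d r (V ∩ O) := by
      by_cases hne : Disjoint (V ∩ O) (A α)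
      · exact ih _ (hV.inter hO) hne
      · obtain ⟨b, hb, hbA⟩ := Set.not_disjoint_iff.1 hne
        exact IsSmallTop.isFinitelySmallTop ⟨hV.inter hO, α,
          hdis.mono_left Set.inter_subset_left, b, ⟨hb, hbA⟩, fun c hc' =>
          hs O (Set.mem_insert O 𝒪) b ⟨hb.2, hbA⟩ c ⟨hc'.1.2, hc'.2⟩⟩
    have h2 : IsFinitelySmallTop A d r (V \ O) := by
      refine ih𝒪 (fun U hU => hc U (Set.mem_insert_of_mem O hU))
        (fun U hU => hs U (Set.mem_insert_of_mem O hU)) _ (hV.diff hO)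
        (hdis.mono_left Set.sdiff_subset) fun x hx => ?_
      rcases hcov ⟨hx.1.1, hx.2⟩ with ⟨U, hU, hxU⟩
      rcases hU with rfl | hU
      · exact absurd hxU hx.1.2
      · exact ⟨U, hU, hxU⟩
    rw [← Set.inter_union_sdiff V O]
    exact h1.union h2 (Set.disjoint_sdiff_right.mono_left Set.inter_subset_right)

variable [CompactSpace K] [T2Space K] [TotallyDisconnectedSpace K]

theorem IsSlicing.isFinitelySmallTop (h : IsSlicing A d r) (α : Ordinal.{w}) :
    ∀ V, IsClopen V → Disjoint V (A α) → IsFinitelySmallTop A d r V := by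
  induction α using Ordinal.limitRecOn with
  | zero =>
    intro V _ hV
    rw [h.zero, Set.disjoint_univ] at hV
    exact hV ▸ isFinitelySmallTop_empty
  | add_one α ih =>
    intro V hV hdis
    have hloc : ∀ b ∈ V ∩ A α, ∃ O : Set K, IsClopen O ∧ b ∈ O ∧
        ∀ x ∈ O ∩ A α, ∀ y ∈ O ∩ A α, d x y ≤ r := by
      intro b hb
      obtain ⟨U, hU, hbU, hsmall⟩ := h.small α b hb.2 (Set.disjoint_left.1 hdis hb.1)
      obtain ⟨O, hO, hbO, hOU⟩ := compact_exists_isClopen_in_isOpen hU hbU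
      exact ⟨O, hO, hbO, fun x hx y hy => hsmall x ⟨hOU hx.1, hx.2⟩ y ⟨hOU hy.1, hy.2⟩⟩
    choose! O hO hbO hsmall using hloc
    obtain ⟨t, ht, hcov⟩ := (hV.isClosed.inter (h.isClosed α)).isCompact.elim_nhds_subcover O
      fun b hb => (hO b hb).isOpen.mem_nhds (hbO b hb)
    refine isFinitelySmallTop_of_cover ih (𝒪 := O '' (t : Set K)) (t.finite_toSet.image O)
      ?_ ?_ V hV hdis ?_
    · rintro _ ⟨b, hb, rfl⟩
      exact hO b (ht b hb)
    · rintro _ ⟨b, hb, rfl⟩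
      exact hsmall b (ht b hb)
    · rw [Set.sUnion_image]
      exact hcov
  | limit α hα ih =>
    intro V hV hdis
    -- by compactness, `V` already misses some earlier set of the sequence
    have hex : ∃ γ : Set.Iio α, V ∩ A γ = ∅ := by
      have : Nonempty (Set.Iio α) := ⟨⟨0, hα.bot_lt⟩⟩
      refine hV.isClosed.isCompact.elim_directed_family_closed
        (fun γ : Set.Iio α => A γ) (fun γ => h.isClosed γ) ?_ ?_
      · rw [h.limit α hα, Set.disjoint_iff_inter_eq_empty] at hdis
        rwa [Set.iInter_subtype]
      · exact directed_of_isDirected_le fun γ δ hγδ => h.antitone hγδ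
    obtain ⟨⟨γ, hγ⟩, hVγ⟩ := hex
    exact ih γ hγ V hV (Set.disjoint_iff_inter_eq_empty.2 hVγ)

end SmallTop

/-- In a tree space, every open set is the disjoint union of sets with small top slice. -/
theorem IsSlicing.exists_partition {T : Type u} [PartialOrder T] [IsTreeOrder T]
    [FinitelyManyInitialNodes T] {A : Ordinal.{w} → Set (TreeSpace T)}
    {d : TreeSpace T → TreeSpace T → ℝ} {r : ℝ} (h : IsSlicing A d r) {σ : Ordinal.{w}}
    (hσ : A σ = ∅) {O : Set (TreeSpace T)} (hO : IsOpen O) :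
    ∃ 𝒲 : Set (Set (TreeSpace T)), 𝒲.PairwiseDisjoint id ∧ (∀ W ∈ 𝒲, IsSmallTop A d r W) ∧
      ⋃₀ 𝒲 = O := by
  obtain ⟨𝒟, hdis, hclopen, rfl⟩ := TreeSpace.exists_clopen_partition hO
  have hfin : ∀ D ∈ 𝒟, IsFinitelySmallTop A d r D := fun D hD =>
    h.isFinitelySmallTop σ D (hclopen D hD) (hσ ▸ Set.disjoint_empty D)
  choose! 𝒲 _ h𝒲 hsmall hcov using hfin
  refine ⟨⋃ D ∈ 𝒟, 𝒲 D, ?_, ?_, ?_⟩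
  · intro V hV W hW hVW
    obtain ⟨D, hD, hVD⟩ := Set.mem_iUnion₂.1 hV
    obtain ⟨E, hE, hWE⟩ := Set.mem_iUnion₂.1 hW
    by_cases hDE : D = E
    · subst hDE
      exact h𝒲 D hD hVD hWE hVW
    · exact (hdis hD hE hDE).mono ((Set.subset_sUnion_of_mem hVD).trans (hcov D hD).subset)
        ((Set.subset_sUnion_of_mem hWE).trans (hcov E hE).subset)
  · intro W hW
    obtain ⟨D, hD, hWD⟩ := Set.mem_iUnion₂.1 hW
    exact hsmall D hD W hWD
  · rw [Set.sUnion_eq_biUnion, Set.sUnion_eq_biUnion]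
    ext x
    simp only [Set.mem_iUnion, exists_prop]
    constructor
    · rintro ⟨W, ⟨D, hD, hWD⟩, hx⟩
      exact ⟨D, hD, hcov D hD ▸ Set.mem_sUnion_of_mem hx hWD⟩
    · rintro ⟨D, hD, hx⟩
      rw [← hcov D hD] at hx
      obtain ⟨W, hWD, hxW⟩ := hx
      exact ⟨W, ⟨D, hD, hWD⟩, hxW⟩

/-! ### Trees of sets -/

/-- The family of sets generated from the sets in `R` by passing from `V` to the members of
`C V`. -/
inductive IsNode {K : Type u} (R : Set (Set K)) (C : Set K → Set (Set K)) : Set K → Prop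
  | root {V : Set K} (hV : V ∈ R) : IsNode R C V
  | child {V W : Set K} (hV : IsNode R C V) (hW : W ∈ C V) : IsNode R C W

/-- The sets generated from `R` by `C`, as a type; it is ordered by reverse inclusion. -/
structure NodeTree {K : Type u} (R : Set (Set K)) (C : Set K → Set (Set K)) : Type u where
  /-- The underlying set. -/
  set : Set K
  isNode : IsNode R C set

/-- `R` is a partition of `K` and the members of `C V` are pairwise disjoint subsets of `V`, not
covering `V` when `V` is a node, on which the rank `ρ` is smaller than at `V`. -/
structure IsRankedSplitting {K : Type u} (R : Set (Set K)) (C : Set K → Set (Set K))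
    (ρ : Set K → Ordinal.{w}) : Prop where
  root_disjoint : R.PairwiseDisjoint id
  root_cover : ⋃₀ R = Set.univ
  disjoint : ∀ V, (C V).PairwiseDisjoint id
  subset : ∀ V, ∀ W ∈ C V, W ⊆ V
  rank_lt : ∀ V, ∀ W ∈ C V, ρ W < ρ V
  nonempty_diff : ∀ V, IsNode R C V → (V \ ⋃₀ C V).Nonempty

namespace NodeTree

variable {K : Type u} {R : Set (Set K)} {C : Set K → Set (Set K)}

instance : PartialOrder (NodeTree R C) where
  le V W := W.set ⊆ V.set
  le_refl _ := subset_rfl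
  le_trans _ _ _ h h' := h'.trans h
  le_antisymm := by
    rintro ⟨V, hV⟩ ⟨W, hW⟩ h h'
    have : V = W := Set.Subset.antisymm h' h
    subst this
    rfl

theorem le_def {V W : NodeTree R C} : V ≤ W ↔ W.set ⊆ V.set := Iff.rfl

theorem set_injective : Function.Injective (NodeTree.set : NodeTree R C → Set K) := by
  rintro ⟨V, hV⟩ ⟨W, hW⟩ rfl
  rfl

variable {ρ : Set K → Ordinal.{w}}

theorem exists_mem_root (h : IsRankedSplitting R C ρ) (c : K) : ∃ V ∈ R, c ∈ V :=
  h.root_cover.symm.subset (Set.mem_univ c)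

open Classical in
/-- The member of `C V` containing `c` if there is one, and `V` itself otherwise. -/
noncomputable def next (C : Set K → Set (Set K)) (c : K) (V : Set K) : Set K :=
  if h : ∃ W ∈ C V, c ∈ W then h.choose else V

theorem next_eq_of_mem (h : IsRankedSplitting R C ρ) {c : K} {V W : Set K} (hW : W ∈ C V)
    (hc : c ∈ W) : next C c V = W := by
  have hex : ∃ W ∈ C V, c ∈ W := ⟨W, hW, hc⟩
  rw [next, dif_pos hex]
  by_contra hne
  exact Set.disjoint_left.1 (h.disjoint V hex.choose_spec.1 hW hne) hex.choose_spec.2 hc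

theorem next_eq_self {c : K} {V : Set K} (hc : c ∉ ⋃₀ C V) : next C c V = V := by
  rw [next, dif_neg]
  rintro ⟨W, hW, hcW⟩
  exact hc ⟨W, hW, hcW⟩

theorem next_eq_or_mem (C : Set K → Set (Set K)) (c : K) (V : Set K) :
    next C c V = V ∨ (next C c V ∈ C V ∧ c ∈ next C c V) := by
  by_cases hex : ∃ W ∈ C V, c ∈ W
  · right
    rw [next, dif_pos hex]
    exact hex.choose_spec
  · left
    rw [next, dif_neg hex]

/-- The nodes containing a point `c`, in decreasing order; the sequence becomes constant at the
smallest of these nodes. -/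
noncomputable def nodeSeq (h : IsRankedSplitting R C ρ) (c : K) (n : ℕ) : Set K :=
  (next C c)^[n] (exists_mem_root h c).choose

theorem nodeSeq_succ (h : IsRankedSplitting R C ρ) (c : K) (n : ℕ) :
    nodeSeq h c (n + 1) = next C c (nodeSeq h c n) :=
  Function.iterate_succ_apply' _ _ _

theorem nodeSeq_spec (h : IsRankedSplitting R C ρ) (c : K) (n : ℕ) :
    IsNode R C (nodeSeq h c n) ∧ c ∈ nodeSeq h c n := by
  induction n with
  | zero =>
    have := (exists_mem_root h c).choose_spec
    exact ⟨.root this.1, this.2⟩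
  | succ n ih =>
    rw [nodeSeq_succ]
    rcases next_eq_or_mem C c (nodeSeq h c n) with h' | h'
    · rwa [h']
    · exact ⟨ih.1.child h'.1, h'.2⟩

theorem exists_eq_nodeSeq (h : IsRankedSplitting R C ρ) {c : K} {V : Set K} (hV : IsNode R C V)
    (hc : c ∈ V) : ∃ n, nodeSeq h c n = V := by
  induction hV with
  | @root V hV =>
    refine ⟨0, ?_⟩
    have hspec := (exists_mem_root h c).choose_spec
    by_contra hne
    exact Set.disjoint_left.1 (h.root_disjoint hspec.1 hV hne) hspec.2 hc
  | @child V W hV hW ih =>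
    obtain ⟨n, hn⟩ := ih (h.subset V W hW hc)
    exact ⟨n + 1, by rw [nodeSeq_succ, hn, next_eq_of_mem h hW hc]⟩

theorem nodeSeq_le (h : IsRankedSplitting R C ρ) (c : K) {m n : ℕ} (hmn : m ≤ n) :
    nodeSeq h c n ⊆ nodeSeq h c m ∧
      (nodeSeq h c n = nodeSeq h c m ∨ ρ (nodeSeq h c n) < ρ (nodeSeq h c m)) := by
  induction n, hmn using Nat.le_induction with
  | base => exact ⟨subset_rfl, Or.inl rfl⟩
  | succ n _ ih =>
    rw [nodeSeq_succ]
    rcases next_eq_or_mem C c (nodeSeq h c n) with h' | ⟨h', -⟩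
    · rwa [h']
    · have hlt := h.rank_lt _ _ h'
      exact ⟨(h.subset _ _ h').trans ih.1, Or.inr (ih.2.elim (fun e => e ▸ hlt) hlt.trans)⟩

theorem subset_or_subset (h : IsRankedSplitting R C ρ) {c : K} {V W : Set K} (hV : IsNode R C V)
    (hW : IsNode R C W) (hcV : c ∈ V) (hcW : c ∈ W) : V ⊆ W ∨ W ⊆ V := by
  obtain ⟨m, rfl⟩ := exists_eq_nodeSeq h hV hcV
  obtain ⟨n, rfl⟩ := exists_eq_nodeSeq h hW hcW
  rcases le_total m n with hmn | hmn
  · exact Or.inr (nodeSeq_le h c hmn).1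
  · exact Or.inl (nodeSeq_le h c hmn).1

theorem node_nonempty (h : IsRankedSplitting R C ρ) (V : NodeTree R C) : V.set.Nonempty :=
  (h.nonempty_diff V.set V.isNode).mono Set.sdiff_subset

theorem rank_lt_of_lt (h : IsRankedSplitting R C ρ) {V W : NodeTree R C} (hVW : V < W) :
    ρ W.set < ρ V.set := by
  obtain ⟨c, hc⟩ := node_nonempty h W
  obtain ⟨n, hn⟩ := exists_eq_nodeSeq h W.isNode hc
  obtain ⟨m, hm⟩ := exists_eq_nodeSeq h V.isNode (hVW.le hc)
  rcases le_total m n with hmn | hmn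
  · have := (nodeSeq_le h c hmn).2
    rw [hn, hm] at this
    exact this.resolve_left fun e => hVW.ne' (set_injective e)
  · have := (nodeSeq_le h c hmn).1
    rw [hn, hm] at this
    exact absurd this hVW.not_ge

/-- A point which lies in no member of `C V` lies in no node properly contained in `V`. -/
theorem le_of_mem_of_notMem (h : IsRankedSplitting R C ρ) {c : K} {V W : NodeTree R C}
    (hcV : c ∈ V.set) (hc : c ∉ ⋃₀ C V.set) (hcW : c ∈ W.set) : W ≤ V := by
  obtain ⟨m, hm⟩ := exists_eq_nodeSeq h V.isNode hcV
  obtain ⟨n, hn⟩ := exists_eq_nodeSeq h W.isNode hcW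
  have hconst : ∀ k, m ≤ k → nodeSeq h c k = V.set := by
    intro k hk
    induction k, hk using Nat.le_induction with
    | base => exact hm
    | succ k _ ih => rw [nodeSeq_succ, ih, next_eq_self hc]
  rw [le_def, ← hn]
  rcases le_total n m with hmn | hmn
  · exact hm ▸ (nodeSeq_le h c hmn).1
  · exact (hconst n hmn).symm.subset

theorem finite_setOf_mem (h : IsRankedSplitting R C ρ) (c : K) :
    {V : NodeTree R C | c ∈ V.set}.Finite := by
  obtain ⟨N, hN⟩ : ∃ N, ∀ n, ρ (nodeSeq h c N) ≤ ρ (nodeSeq h c n) :=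
    ⟨_, fun n => Function.argmin_le (fun n => ρ (nodeSeq h c n)) n⟩
  refine Set.Finite.of_finite_image (f := NodeTree.set) ?_ set_injective.injOn
  refine ((Set.finite_Iic N).image (nodeSeq h c)).subset ?_
  rintro _ ⟨V, hV, rfl⟩
  obtain ⟨n, hn⟩ := exists_eq_nodeSeq h V.isNode hV
  rcases le_total n N with hnN | hnN
  · exact ⟨n, hnN, hn⟩
  · exact ⟨N, Set.self_mem_Iic, hn ▸ ((nodeSeq_le h c hnN).2.resolve_right (hN n).not_gt).symm⟩

theorem isTreeOrder (h : IsRankedSplitting R C ρ) : IsTreeOrder (NodeTree R C) := by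
  refine ⟨fun V => ?_, fun V W hW W' hW' _ => ?_⟩
  · obtain ⟨c, hc⟩ := node_nonempty h V
    exact (finite_setOf_mem h c).subset fun W hW => hW hc
  · obtain ⟨c, hc⟩ := node_nonempty h V
    exact (subset_or_subset h W.isNode W'.isNode (hW hc) (hW' hc)).symm

theorem finitelyManyInitialNodes (h : IsRankedSplitting R C ρ) (hR : R.Finite) :
    FinitelyManyInitialNodes (NodeTree R C) := by
  refine ⟨Set.Finite.of_finite_image (f := NodeTree.set) (hR.subset ?_) set_injective.injOn⟩
  rintro _ ⟨⟨W, hW⟩, hmin, rfl⟩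
  cases hW with
  | root hW => exact hW
  | @child V _ hV hW =>
    have hle : (⟨V, hV⟩ : NodeTree R C) ≤ ⟨W, hV.child hW⟩ := h.subset V W hW
    have := hmin hle
    exact absurd (h.rank_lt V W hW) (congrArg ρ (Set.Subset.antisymm (h.subset V W hW) this)).not_lt

theorem isWellFoundedTree (h : IsRankedSplitting R C ρ) : IsWellFoundedTree (NodeTree R C) := by
  intro b
  have := isTreeOrder h
  have : Nonempty b.carrier := b.isBranch.nonempty.to_subtype
  obtain ⟨⟨V, hV⟩, hmin⟩ : ∃ V : b.carrier, ∀ W : b.carrier, ρ V.1.set ≤ ρ W.1.set :=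
    ⟨_, fun W => Function.argmin_le (fun V : b.carrier => ρ V.1.set) W⟩
  refine (IsTreeOrder.finite_Iic V).subset fun W hW => ?_
  rcases b.isBranch.isChain.total hW hV with hle | hle
  · exact hle
  · rcases hle.eq_or_lt with rfl | hlt
    · exact Set.self_mem_Iic
    · exact absurd (rank_lt_of_lt h hlt) (hmin ⟨W, hW⟩).not_gt

/-- The rank of a node bounds the number of derivations that the node survives. -/
theorem iterDeriv_removeMaximal_subset (h : IsRankedSplitting R C ρ) (α : Ordinal.{w}) :
    iterDeriv removeMaximal (Set.univ : Set (NodeTree R C)) α ⊆ {V | α ≤ ρ V.set} := by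
  induction α using Ordinal.limitRecOn with
  | zero => exact fun V _ => zero_le (a := ρ V.set)
  | add_one α ih =>
    rw [iterDeriv_add_one]
    rintro V ⟨hV, hmax⟩
    obtain ⟨W, hW, hVW⟩ : ∃ W ∈ iterDeriv removeMaximal Set.univ α, V < W := by
      by_contra! hno
      exact hmax (maximal_iff_forall_gt.2 ⟨hV, fun W hVW hW => hno W hW hVW⟩)
    exact Order.add_one_le_of_lt ((ih hW).trans_lt (rank_lt_of_lt h hVW))
  | limit α hα ih =>
    rw [iterDeriv_limit hα]
    exact fun V hV => hα.le_iff_forall_le.2 fun γ hγ => ih γ hγ (Set.mem_iInter₂.1 hV γ hγ)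

theorem treeIndex_le {ρ : Set K → Ordinal.{max u v}} (h : IsRankedSplitting R C ρ)
    {σ : Ordinal.{max u v}}
    (hσ : ∀ V, IsNode R C V → ρ V < σ) : treeIndex.{u, v} (NodeTree R C) ≤ σ :=
  derivIndex_le <| Set.eq_empty_of_forall_notMem fun V hV =>
    (iterDeriv_removeMaximal_subset h σ hV).not_gt (hσ V.set V.isNode)

/-- The branch of all nodes containing a given point. -/
def toBranch (h : IsRankedSplitting R C ρ) (c : K) : TreeSpace (NodeTree R C) where
  carrier := {V | c ∈ V.set}
  isBranch :=
    ⟨(exists_mem_root h c).elim fun V hV => ⟨⟨V, .root hV.1⟩, hV.2⟩,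
      fun V hV W hW _ => (subset_or_subset h V.isNode W.isNode hV hW).symm,
      fun _ hV _ hWV => hWV.le hV⟩

theorem toBranch_eq_iff (h : IsRankedSplitting R C ρ) {V : NodeTree R C} {c : K} :
    (toBranch h c).carrier = Set.Iic V ↔ c ∈ V.set \ ⋃₀ C V.set := by
  constructor
  · intro hc
    have hcV : V ∈ (toBranch h c).carrier := hc ▸ (le_rfl : V ≤ V)
    refine ⟨hcV, ?_⟩
    rintro ⟨W, hW, hcW⟩
    have : (⟨W, V.isNode.child hW⟩ : NodeTree R C) ∈ (toBranch h c).carrier := hcW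
    rw [hc] at this
    exact (h.rank_lt _ _ hW).ne (congrArg ρ (Set.Subset.antisymm (h.subset _ _ hW) this))
  · rintro ⟨hcV, hc⟩
    exact Set.Subset.antisymm (fun W hW => le_of_mem_of_notMem h hcV hc hW) fun W hW => hW hcV

/-- Every branch is finite, hence consists of the predecessors of some node `V`, and the points
mapped to it are the points of `V` outside the members of `C V`. -/
theorem exists_toBranch_fiber (h : IsRankedSplitting R C ρ) (b : TreeSpace (NodeTree R C)) :
    ∃ V : NodeTree R C, ∀ c, toBranch h c = b ↔ c ∈ V.set \ ⋃₀ C V.set := by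
  have := isTreeOrder h
  obtain ⟨V, -, rfl⟩ := b.eq_ofNode_of_finite (isWellFoundedTree h b)
  exact ⟨V, fun c => by rw [← toBranch_eq_iff h, TreeSpace.ext_iff]; rfl⟩

theorem continuous_toBranch [TopologicalSpace K] (h : IsRankedSplitting R C ρ)
    (hclopen : ∀ V, IsNode R C V → IsClopen V) : Continuous (toBranch h) :=
  TreeSpace.continuous_iff.2 fun V => hclopen V.set V.isNode

end NodeTree

/-! ### A quotient onto a well-founded tree space -/

section Quotient

variable {T : Type u} [PartialOrder T] [IsTreeOrder T] [FinitelyManyInitialNodes T]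

/-- A set `V` with small top slice is cut along the `d`-ball of radius `r` around a centre of its
top slice: the part of `V` outside this ball is split into sets with small top slice, which have
smaller rank since the ball contains the whole top slice of `V`. -/
theorem IsSlicing.exists_splitting {A : Ordinal.{w} → Set (TreeSpace T)}
    {d : TreeSpace T → TreeSpace T → ℝ} {r : ℝ} (h : IsSlicing A d r) {σ : Ordinal.{w}}
    (hσ : A σ = ∅) (hr : ∀ b, d b b ≤ r) (V : Set (TreeSpace T)) :
    ∃ 𝒲 : Set (Set (TreeSpace T)), 𝒲.PairwiseDisjoint id ∧
      (∀ W ∈ 𝒲, IsSmallTop A d r W ∧ W ⊆ V ∧ topRank A W < topRank A V) ∧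
      (IsSmallTop A d r V → ∃ b ∈ V \ ⋃₀ 𝒲, ∀ c ∈ V \ ⋃₀ 𝒲, d b c ≤ r) := by
  by_cases hV : IsSmallTop A d r V
  · obtain ⟨b, hb, hball⟩ := hV.exists_center h.antitone
    obtain ⟨𝒲, hdis, hsmall, hcov⟩ :=
      h.exists_partition hσ (hV.1.isOpen.sdiff (h.isClosed_ball b))
    refine ⟨𝒲, hdis, fun W hW => ?_, fun _ => ⟨b, ⟨hb.1, ?_⟩, fun c hc => ?_⟩⟩
    · have hWV : W ⊆ V \ {c | d b c ≤ r} := hcov ▸ Set.subset_sUnion_of_mem hW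
      refine ⟨hsmall W hW, hWV.trans Set.sdiff_subset, (hsmall W hW).topRank_lt h.antitone ?_⟩
      exact Set.disjoint_left.2 fun c hcW hcA => (hWV hcW).2 (hball c ⟨(hWV hcW).1, hcA⟩)
    · rw [hcov]
      exact fun hb' => hb'.2 (hr b)
    · by_contra hcb
      exact hc.2 (hcov.symm ▸ ⟨hc.1, hcb⟩)
  · exact ⟨∅, Set.pairwiseDisjoint_empty, by simp, fun h' => absurd h' hV⟩

/-- A slicing of the tree space of length `σ` gives a continuous map onto the tree space of a
well-founded compact tree of index at most `σ`, each fibre being contained in a `d`-ball of radius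
`r` around one of its points. -/
theorem IsSlicing.exists_quotient {A : Ordinal.{max u v} → Set (TreeSpace T)}
    {d : TreeSpace T → TreeSpace T → ℝ} {r : ℝ} (h : IsSlicing A d r) {σ : Ordinal.{max u v}}
    (hσ : A σ = ∅) (hr : ∀ b, d b b ≤ r) :
    ∃ (S : Type u) (_ : PartialOrder S) (_ : IsTreeOrder S) (_ : FinitelyManyInitialNodes S),
      IsWellFoundedTree S ∧ treeIndex.{u, v} S ≤ σ ∧
      ∃ q : C(TreeSpace T, TreeSpace S),
        ∀ y, ∃ b, q b = y ∧ ∀ c, q c = y → d b c ≤ r := by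
  obtain ⟨R, hRfin, hRdis, hRsmall, hRcov⟩ :=
    h.isFinitelySmallTop σ Set.univ isClopen_univ (hσ ▸ Set.disjoint_empty _)
  choose C hCdis hC hcenter using h.exists_splitting hσ hr
  have hnode : ∀ V, IsNode R C V → IsSmallTop A d r V := by
    intro V hV
    induction hV with
    | root hV => exact hRsmall _ hV
    | child _ hW _ => exact (hC _ _ hW).1
  have hsplit : IsRankedSplitting R C (topRank A) :=
    { root_disjoint := hRdis
      root_cover := hRcov
      disjoint := hCdis
      subset := fun V W hW => (hC V W hW).2.1
      rank_lt := fun V W hW => (hC V W hW).2.2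
      nonempty_diff := fun V hV => (hcenter V (hnode V hV)).imp fun _ hb => hb.1 }
  refine ⟨NodeTree R C, inferInstance, NodeTree.isTreeOrder hsplit,
    NodeTree.finitelyManyInitialNodes hsplit hRfin, NodeTree.isWellFoundedTree hsplit,
    NodeTree.treeIndex_le hsplit fun V hV => (hnode V hV).topRank_lt h.antitone
      (hσ ▸ Set.disjoint_empty _),
    ⟨NodeTree.toBranch hsplit, NodeTree.continuous_toBranch hsplit fun V hV => (hnode V hV).1⟩,
    fun y => ?_⟩
  obtain ⟨V, hV⟩ := NodeTree.exists_toBranch_fiber hsplit y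
  obtain ⟨b, hb, hball⟩ := hcenter V.set (hnode V.set V.isNode)
  exact ⟨b, (hV b).2 hb, fun c hc => hball c ((hV c).1 hc)⟩

end Quotient

/-! ### Functions with small oscillation on the fibres of a quotient map -/

section Approximation

variable {K : Type u} {L : Type v} [TopologicalSpace K] [CompactSpace K] [TopologicalSpace L]
  [CompactSpace L]

/-- Composition with a continuous surjection, as a linear isometry. -/
noncomputable def compSurjective (q : C(K, L)) (hq : Function.Surjective q) :
    C(L, ℝ) →ₗᵢ[ℝ] C(K, ℝ) where
  toFun g := g.comp q
  map_add' _ _ := rfl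
  map_smul' _ _ := rfl
  norm_map' g := by
    refine le_antisymm ?_ ?_
    · exact (ContinuousMap.norm_le _ (norm_nonneg g)).2 fun c => g.norm_coe_le_norm (q c)
    · refine (ContinuousMap.norm_le _ (norm_nonneg _)).2 fun y => ?_
      obtain ⟨c, rfl⟩ := hq y
      exact (g.comp q).norm_coe_le_norm c

/-- If `f` is strictly within `δ` of a constant on each fibre of `q`, then the same constant works
on all nearby fibres, and a partition of unity glues these constants. -/
theorem exists_abs_sub_comp_le [T2Space L] (q : C(K, L)) (f : C(K, ℝ)) {δ : ℝ}
    (hf : ∀ y, ∃ a : ℝ, ∀ c, q c = y → |f c - a| < δ) :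
    ∃ g : C(L, ℝ), ∀ c, |f c - g (q c)| ≤ δ := by
  have hclosed : IsClosedMap q := q.continuous.isClosedMap
  have hconvex : ∀ y, Convex ℝ {a : ℝ | ∀ c, q c = y → |f c - a| ≤ δ} := by
    intro y
    have : {a : ℝ | ∀ c, q c = y → |f c - a| ≤ δ} =
        ⋂ (c) (_ : q c = y), Metric.closedBall (f c) δ := by
      ext a
      simp [Real.dist_eq, abs_sub_comm]
    rw [this]
    exact convex_iInter₂ fun c _ => convex_closedBall _ _
  have hlocal : ∀ y, ∃ a : ℝ, ∀ᶠ z in nhds y, a ∈ {a : ℝ | ∀ c, q c = z → |f c - a| ≤ δ} := by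
    intro y
    obtain ⟨a, ha⟩ := hf y
    have hopen : IsOpen {c | |f c - a| < δ} :=
      isOpen_lt (f.continuous.sub continuous_const).abs continuous_const
    exact ⟨a, hclosed.eventually_nhds_fiber (p := fun c => |f c - a| ≤ δ) y fun c hc =>
      Filter.mem_of_superset (hopen.mem_nhds (ha c hc)) fun z (hz : |f z - a| < δ) => hz.le⟩
  obtain ⟨g, hg⟩ := exists_continuous_forall_mem_convex_of_local_const hconvex hlocal
  exact ⟨g, fun c => hg (q c) c rfl⟩

end Approximation

/-! ### The slicing given by the Szlenk derivatives -/

section Evaluation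

variable {X : Type u} [NormedAddCommGroup X] [NormedSpace ℝ X]

theorem WeakDual.isSlicing_preimage {K : Type v} [TopologicalSpace K] {φ : K → WeakDual ℝ X}
    (hφ : Continuous φ) (hball : ∀ c, ‖WeakDual.toStrongDual (φ c)‖ ≤ 1) (ε : ℝ) :
    IsSlicing
      (fun α : Ordinal.{w} => φ ⁻¹' iterDeriv
        (fragDeriv (fun f g => ‖WeakDual.toStrongDual f - WeakDual.toStrongDual g‖) ε)
        {f | ‖WeakDual.toStrongDual f‖ ≤ 1} α)
      (fun b c => ‖WeakDual.toStrongDual (φ b) - WeakDual.toStrongDual (φ c)‖) ε where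
  zero := by
    rw [iterDeriv_zero]
    exact Set.eq_univ_of_forall hball
  antitone := fun α β hαβ => Set.preimage_mono (iterDeriv_antitone fragDeriv_subset hαβ)
  limit := fun α hα => by
    rw [iterDeriv_limit hα]
    simp only [Set.preimage_iInter]
  isClosed := fun α => by
    refine (IsClosed.iterDeriv_fragDeriv ?_ α).preimage hφ
    convert WeakDual.isClosed_closedBall (𝕜 := ℝ) (E := X) 0 1 using 1
    ext f
    simp
  small := fun α b hb hb' => by
    rw [iterDeriv_add_one] at hb'
    by_contra! hno
    refine hb' ⟨hb, fun U hU hbU => not_lt.1 fun hlt => ?_⟩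
    obtain ⟨x, hx, y, hy, hxy⟩ := hno (φ ⁻¹' U) (hU.preimage hφ) hbU
    exact hxy.not_ge (le_of_diamWrt_lt
      (d := fun f g : WeakDual ℝ X => ‖WeakDual.toStrongDual f - WeakDual.toStrongDual g‖)
      hlt hx hy)
  isClosed_ball := fun b => by
    convert (WeakDual.isClosed_closedBall (𝕜 := ℝ) (E := X)
      (WeakDual.toStrongDual (φ b)) ε).preimage hφ using 1
    ext c
    simp [dist_eq_norm, norm_sub_rev]

variable {K : Type v} [TopologicalSpace K] [CompactSpace K]

/-- The functional `x ↦ i x c` for a point `c` of `K`. -/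
noncomputable def evalDual (i : X →ₗᵢ[ℝ] C(K, ℝ)) (c : K) : WeakDual ℝ X :=
  StrongDual.toWeakDual ((ContinuousMap.evalCLM ℝ c).comp i.toContinuousLinearMap)

theorem continuous_evalDual (i : X →ₗᵢ[ℝ] C(K, ℝ)) : Continuous (evalDual i) :=
  WeakDual.continuous_of_continuous_eval fun x => (i x).continuous

theorem norm_evalDual_le (i : X →ₗᵢ[ℝ] C(K, ℝ)) (c : K) :
    ‖WeakDual.toStrongDual (evalDual i c)‖ ≤ 1 := by
  refine ContinuousLinearMap.opNorm_le_bound _ zero_le_one fun x => ?_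
  rw [one_mul, ← i.norm_map x]
  exact (i x).norm_coe_le_norm c

theorem abs_apply_sub_apply_le (i : X →ₗᵢ[ℝ] C(K, ℝ)) (b c : K) (x : X) :
    |i x c - i x b| ≤
      ‖WeakDual.toStrongDual (evalDual i b) - WeakDual.toStrongDual (evalDual i c)‖ * ‖x‖ := by
  rw [abs_sub_comm]
  exact (WeakDual.toStrongDual (evalDual i b) -
    WeakDual.toStrongDual (evalDual i c)).le_opNorm x

end Evaluation

theorem theorem5p1 {X : Type u} [NormedAddCommGroup X] [NormedSpace ℝ X] [CompleteSpace X]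
    (hX : IsAsplund X) {T : Type v} [PartialOrder T] [IsTreeOrder T] [FinitelyManyInitialNodes T]
    (i : X →ₗᵢ[ℝ] C(TreeSpace T, ℝ)) (ε : ℝ) (hε : 0 < ε) :
    szlenkIndex.{u, v} X (ε / 2) ≠ ⊤ ∧
    ∃ (S : Type v) (_ : PartialOrder S) (_ : IsTreeOrder S) (_ : FinitelyManyInitialNodes S),
      IsWellFoundedTree S ∧
      treeIndex.{v, u} S < szlenkIndex.{u, v} X (ε / 2) + (Ordinal.omega0.{max u v} : WithTop _) ∧
      ∃ Y : Submodule ℝ C(TreeSpace T, ℝ),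
        Nonempty (C(TreeSpace S, ℝ) ≃ₗᵢ[ℝ] Y) ∧
        ∀ x : X, ∃ y ∈ Y, ‖i x - y‖ ≤ ε * ‖x‖ := by
  have hSz := hX.szlenkIndex_ne_top.{u, v} (half_pos hε)
  refine ⟨hSz, ?_⟩
  obtain ⟨σ, hσ, hempty⟩ := exists_iterDeriv_empty_of_derivIndex_ne_top hSz
  obtain ⟨S, _, _, _, hwf, hindex, q, hq⟩ :=
    (WeakDual.isSlicing_preimage (continuous_evalDual i) (norm_evalDual_le i)
      (ε / 2)).exists_quotient.{v, u} (σ := σ) (by rw [hempty, Set.preimage_empty])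
      fun b => by rw [sub_self, norm_zero]; exact (half_pos hε).le
  have hsurj : Function.Surjective q := fun y => (hq y).imp fun _ hb => hb.1
  refine ⟨S, inferInstance, inferInstance, inferInstance, hwf, ?_,
    LinearMap.range (compSurjective q hsurj).toLinearMap,
    ⟨(compSurjective q hsurj).equivRange⟩, fun x => ?_⟩
  · have hσ' : szlenkIndex.{u, v} X (ε / 2) = σ := hσ
    rw [hσ', ← WithTop.coe_add]
    refine hindex.trans_lt (WithTop.coe_lt_coe.2 ?_)
    exact lt_add_of_pos_right σ Ordinal.omega0_pos
  · -- the oscillation estimate below is strict, so `x = 0` is treated apart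
    rcases eq_or_ne x 0 with rfl | hx
    · exact ⟨0, Submodule.zero_mem _, by simp⟩
    have hxpos : 0 < ‖x‖ := norm_pos_iff.2 hx
    have hosc : ∀ y, ∃ a : ℝ, ∀ c, q c = y → |i x c - a| < ε * ‖x‖ := by
      intro y
      obtain ⟨b, -, hball⟩ := hq y
      refine ⟨i x b, fun c hc => (abs_apply_sub_apply_le i b c x).trans_lt ?_⟩
      exact mul_lt_mul_of_pos_right ((hball c hc).trans_lt (half_lt_self hε)) hxpos
    obtain ⟨g, hg⟩ := exists_abs_sub_comp_le q (i x) hosc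
    exact ⟨compSurjective q hsurj g, ⟨g, rfl⟩,
      (ContinuousMap.norm_le _ (mul_nonneg hε.le (norm_nonneg x))).2 hg⟩
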